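/- Let $P$ be a set of propositional letters. Formulas over $P$ are generated from the letters in $P$ by $\top,\bot,\wedge,\vee,\Box,\Diamond$ (there is no negation or implication). A consequence pair is an expression $\phi\trianglelefteq\psi$ with $\phi,\psi$ formulas. For a set $\Gamma$ of consequence pairs, the weak positive modal logic $\mathcal L(\Gamma)$ is the smallest set of consequence pairs that contains $\Gamma$, is closed under uniform substitution, contains all pairs $$\phi\trianglelefteq\top,\quad \bot\trianglelefteq\phi,\quad \phi\trianglelefteq\phi,\quad \phi\wedge\psi\trianglelefteq\phi,\quad \phi\wedge\psi\trianglelefteq\psi,\quad \phi\trianglelefteq\phi\vee\psi,\quad \psi\trianglelefteq\phi\vee\psi,$$ $$\top\trianglelefteq\Box\top,\quad \top\trianglelefteq\Diamond\top,\quad \Box\phi\wedge\Box\psi\trianglelefteq\Box(\phi\wedge\psi),\quad \Diamond\phi\wedge\Box\psi\trianglelefteq\Diamond(\phi\wedge\psi),$$ and is closed under the rules: from $\phi\trianglelefteq\psi$ and $\psi\trianglelefteq\chi$ infer $\phi\trianglelefteq\chi$; from $\phi\trianglelefteq\psi$ and $\phi\trianglelefteq\chi$ infer $\phi\trianglelefteq\psi\wedge\chi$;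 from $\phi\trianglelefteq\chi$ and $\psi\trianglelefteq\chi$ infer $\phi\vee\psi\trianglelefteq\chi$; from $\phi\trianglelefteq\psi$ infer $\Box\phi\trianglelefteq\Box\psi$ and $\Diamond\phi\trianglelefteq\Diamond\psi$. Write $\phi\vdash_\Gamma\psi$ if $\phi\trianglelefteq\psi\in\mathcal L(\Gamma)$. $\mathcal L(\Gamma)$ has the Craig interpolation property if for all pairwise disjoint sets $\overline p,\overline q,\overline r\subseteq P$ and all formulas $\phi$ with letters in $\overline p\cup\overline q$ and $\psi$ with letters in $\overline p\cup\overline r$ such that $\phi\vdash_\Gamma\psi$, there is a formula $\chi$ with letters in $\overline p$ such that $\phi\vdash_\Gamma\chi$ and $\chi\vdash_\Gamma\psi$. For a letter $p\in P$, consider the axioms - $\mathsf T$: $\Box p\trianglelefteq p$ and $p\trianglelefteq\Diamond p$; - $\mathsf 4$: $\Box p\trianglelefteq\Box\Box p$ and $\Diamond\Diamond p\trianglelefteq\Diamond p$; - $\mathsf B$: $p\trianglelefteq\Box\Diamond p$ and $\Diamond\Box p\trianglelefteq p$; - $\mathsf 5$: $\Diamond p\trianglelefteq\Box\Diamond p$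 and $\Diamond\Box p\trianglelefteq\Box p$; - $\mathsf{.2}$: $\Diamond\Box p\trianglelefteq\Box\Diamond p$. **Theorem.** For every $\Gamma\subseteq\{\mathsf T,\mathsf 4,\mathsf B,\mathsf 5,\mathsf{.2}\}$, the logic $\mathcal L(\Gamma)$ has the Craig interpolation property. In particular this holds for the Church–Rosser logic $\mathcal L(\{\mathsf{.2}\})$. In contrast, over any infinite set of letters, the classical modal logic $\mathsf{K.2}$ (the smallest normal modal logic containing $\Diamond\Box p\to\Box\Diamond p$) lacks the Craig interpolation property: there are pairwise disjoint sets of letters $\overline p,\overline q,\overline r$ and classical modal formulas $\phi$ with letters in $\overline p\cup\overline q$ and $\psi$ with letters in $\overline p\cup\overline r$ such that $\phi\to\psi\in\mathsf{K.2}$, but no formula $\chi$ with letters in $\overline p$ satisfies $\phi\to\chi\in\mathsf{K.2}$ and $\chi\to\psi\in\mathsf{K.2}$. -/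

import Mathlib

namespace WeakPositive

/-- Formulas of the language of modal lattices over a set `P` of propositional letters. -/
inductive Fm (P : Type*) where
  | var : P → Fm P
  | top : Fm P
  | bot : Fm P
  | and : Fm P → Fm P → Fm P
  | or : Fm P → Fm P → Fm P
  | box : Fm P → Fm P
  | dia : Fm P → Fm P

namespace Fm

/-- The set of propositional letters occurring in a formula. -/
def vars {P : Type*} : Fm P → Set P
  | var p => {p}
  | top => ∅
  | bot => ∅
  | and φ ψ => φ.vars ∪ ψ.vars
  | or φ ψ => φ.vars ∪ ψ.vars
  | box φ => φ.vars
  | dia φ => φ.vars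

/-- Uniform substitution. -/
def subst {P : Type*} (σ : P → Fm P) : Fm P → Fm P
  | var p => σ p
  | top => top
  | bot => bot
  | and φ ψ => and (φ.subst σ) (ψ.subst σ)
  | or φ ψ => or (φ.subst σ) (ψ.subst σ)
  | box φ => box (φ.subst σ)
  | dia φ => dia (φ.subst σ)

/-- The formulas all of whose letters belong to `S`. -/
def formulasOver {P : Type*} (S : Set P) : Set (Fm P) := {φ | φ.vars ⊆ S}

end Fm

/-- A consequence pair `lhs ⊴ rhs`. -/
structure Pair (P : Type*) where
  lhs : Fm P
  rhs : Fm P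

/-- `Derives Γ φ ψ` : the pair `φ ⊴ ψ` is derivable from the set `Γ` of consequence pairs by
the axioms and rules of weak positive modal logic and uniform substitution. -/
inductive Derives {P : Type*} (Γ : Set (Pair P)) : Fm P → Fm P → Prop where
  | ax {π : Pair P} : π ∈ Γ → Derives Γ π.lhs π.rhs
  | subst (σ : P → Fm P) {φ ψ : Fm P} : Derives Γ φ ψ → Derives Γ (φ.subst σ) (ψ.subst σ)
  | le_top (φ : Fm P) : Derives Γ φ .top
  | bot_le (φ : Fm P) : Derives Γ .bot φ
  | refl (φ : Fm P) : Derives Γ φ φ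
  | trans {φ ψ χ : Fm P} : Derives Γ φ ψ → Derives Γ ψ χ → Derives Γ φ χ
  | and_left (φ ψ : Fm P) : Derives Γ (.and φ ψ) φ
  | and_right (φ ψ : Fm P) : Derives Γ (.and φ ψ) ψ
  | or_left (φ ψ : Fm P) : Derives Γ φ (.or φ ψ)
  | or_right (φ ψ : Fm P) : Derives Γ ψ (.or φ ψ)
  | le_and {φ ψ χ : Fm P} : Derives Γ φ ψ → Derives Γ φ χ → Derives Γ φ (.and ψ χ)
  | or_le {φ ψ χ : Fm P} : Derives Γ φ χ → Derives Γ ψ χ → Derives Γ (.or φ ψ) χ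
  | box_top : Derives Γ .top (.box .top)
  | dia_top : Derives Γ .top (.dia .top)
  | box_mono {φ ψ : Fm P} : Derives Γ φ ψ → Derives Γ (.box φ) (.box ψ)
  | dia_mono {φ ψ : Fm P} : Derives Γ φ ψ → Derives Γ (.dia φ) (.dia ψ)
  | linearity (φ ψ : Fm P) : Derives Γ (.and (.box φ) (.box ψ)) (.box (.and φ ψ))
  | duality (φ ψ : Fm P) : Derives Γ (.and (.dia φ) (.box ψ)) (.dia (.and φ ψ))

/-- The weak positive modal logic axiomatized by `Γ`: the smallest set of consequence pairs that
contains `Γ` and is closed under uniform substitution and the axioms and rules. -/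
def logic {P : Type*} (Γ : Set (Pair P)) : Set (Pair P) := {π | Derives Γ π.lhs π.rhs}

/-- The Craig interpolation property for a set of consequence pairs. -/
def CraigInterpolation {P : Type*} (L : Set (Pair P)) : Prop :=
  ∀ p q r : Set P, Disjoint p q → Disjoint p r → Disjoint q r →
    ∀ φ ∈ Fm.formulasOver (p ∪ q), ∀ ψ ∈ Fm.formulasOver (p ∪ r), ⟨φ, ψ⟩ ∈ L →
      ∃ χ ∈ Fm.formulasOver p, ⟨φ, χ⟩ ∈ L ∧ ⟨χ, ψ⟩ ∈ L

/-- Names of the axioms T, 4, B, 5 and .2. -/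
inductive AxiomName where
  | T
  | four
  | B
  | five
  | dot2

open Fm in
/-- The consequence pairs which make up each axiom, written with the letter `p`. -/
def AxiomName.pairs {P : Type*} (p : P) : AxiomName → Set (Pair P)
  | T => {⟨box (var p), var p⟩, ⟨var p, dia (var p)⟩}
  | four => {⟨box (var p), box (box (var p))⟩, ⟨dia (dia (var p)), dia (var p)⟩}
  | B => {⟨var p, box (dia (var p))⟩, ⟨dia (box (var p)), var p⟩}
  | five => {⟨dia (var p), box (dia (var p))⟩, ⟨dia (box (var p)), box (var p)⟩}
  | dot2 => {⟨dia (box (var p)), box (dia (var p))⟩}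

end WeakPositive

namespace ClassicalModal

/-- Formulas of classical modal logic over a set `P` of propositional letters, with primitive
connectives `⊥`, `→`, `□`. -/
inductive Fm (P : Type*) where
  | var : P → Fm P
  | bot : Fm P
  | imp : Fm P → Fm P → Fm P
  | box : Fm P → Fm P

namespace Fm

/-- Classical negation. -/
def neg {P : Type*} (φ : Fm P) : Fm P := imp φ bot

/-- `◇φ` is `¬□¬φ`. -/
def dia {P : Type*} (φ : Fm P) : Fm P := neg (box (neg φ))

/-- The set of propositional letters occurring in a formula. -/
def vars {P : Type*} : Fm P → Set P
  | var p => {p}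
  | bot => ∅
  | imp φ ψ => φ.vars ∪ ψ.vars
  | box φ => φ.vars

/-- Uniform substitution. -/
def subst {P : Type*} (σ : P → Fm P) : Fm P → Fm P
  | var p => σ p
  | bot => bot
  | imp φ ψ => imp (φ.subst σ) (ψ.subst σ)
  | box φ => box (φ.subst σ)

/-- The formulas all of whose letters belong to `S`. -/
def formulasOver {P : Type*} (S : Set P) : Set (Fm P) := {φ | φ.vars ⊆ S}

end Fm

/-- Derivability in the smallest normal modal logic containing `Γ`. The constructors `weak`,
`distr` and `dne`, with modus ponens, axiomatize classical propositional logic. -/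
inductive Derives {P : Type*} (Γ : Set (Fm P)) : Fm P → Prop where
  | ax {φ : Fm P} : φ ∈ Γ → Derives Γ φ
  | subst (σ : P → Fm P) {φ : Fm P} : Derives Γ φ → Derives Γ (φ.subst σ)
  | weak (φ ψ : Fm P) : Derives Γ (.imp φ (.imp ψ φ))
  | distr (φ ψ χ : Fm P) :
      Derives Γ (.imp (.imp φ (.imp ψ χ)) (.imp (.imp φ ψ) (.imp φ χ)))
  | dne (φ : Fm P) : Derives Γ (.imp (.neg (.neg φ)) φ)
  | mp {φ ψ : Fm P} : Derives Γ (.imp φ ψ) → Derives Γ φ → Derives Γ ψ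
  | boxK (φ ψ : Fm P) : Derives Γ (.imp (.box (.imp φ ψ)) (.imp (.box φ) (.box ψ)))
  | nec {φ : Fm P} : Derives Γ φ → Derives Γ (.box φ)

/-- The smallest normal modal logic containing `Γ`. -/
def logic {P : Type*} (Γ : Set (Fm P)) : Set (Fm P) := {φ | Derives Γ φ}

/-- The modal logic K.2, axiomatized by `◇□p → □◇p`. -/
def K2 {P : Type*} (p : P) : Set (Fm P) :=
  logic {.imp (.dia (.box (.var p))) (.box (.dia (.var p)))}

/-- The Craig interpolation property for a set of classical modal formulas. -/
def CraigInterpolation {P : Type*} (L : Set (Fm P)) : Prop :=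
  ∀ p q r : Set P, Disjoint p q → Disjoint p r → Disjoint q r →
    ∀ φ ∈ Fm.formulasOver (p ∪ q), ∀ ψ ∈ Fm.formulasOver (p ∪ r), Fm.imp φ ψ ∈ L →
      ∃ χ ∈ Fm.formulasOver p, Fm.imp φ χ ∈ L ∧ Fm.imp χ ψ ∈ L

end ClassicalModal

/-!
A positive modal formula is monotone in its letters, so replacing by `⊤` the letters which occur
in the antecedent only weakens the antecedent; the substitution leaves the consequent unchanged,
and hence yields an interpolant over any set of axioms.

In contrast, `K.2` proves `◇□α ∧ ◇□β → ◇◇(α ∧ β)`. Let `fork α β` say that `◇□α`, `◇□β` and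
`□(□α ∨ □β)`. If the four formulas `α, β, γ, δ` are jointly contradictory, then so are `fork α β`
and `fork γ δ` over `K.2`: one of the two ways of pairing `α, β` with `γ, δ` yields two successors
which together force all four formulas. With `α = q`, `β = q → s`, `γ = r`, `δ = r → ¬s` the only
common letter is `s`, and the two forks are satisfied at points of confluent models which are
bisimilar with respect to `s`, so that no formula in `s` separates them.
-/

namespace WeakPositive

variable {P : Type*} {Γ : Set (Pair P)} {σ : P → Fm P}

namespace Fm

theorem vars_subst (σ : P → Fm P) (φ : Fm P) :
    (φ.subst σ).vars = ⋃ s ∈ φ.vars, (σ s).vars := by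
  induction φ with
  | var s => simp only [subst, vars, Set.biUnion_singleton]
  | top | bot => simp only [subst, vars, Set.biUnion_empty]
  | and _ _ ihφ ihψ | or _ _ ihφ ihψ => simp only [subst, vars, Set.biUnion_union, ihφ, ihψ]
  | box _ ih | dia _ ih => exact ih

theorem subst_eq_self {φ : Fm P} (hσ : ∀ s ∈ φ.vars, σ s = .var s) : φ.subst σ = φ := by
  induction φ <;> simp_all [subst, vars]

end Fm

namespace Derives

theorem and_mono {φ φ' ψ ψ' : Fm P} (hφ : Derives Γ φ φ') (hψ : Derives Γ ψ ψ') :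
    Derives Γ (.and φ ψ) (.and φ' ψ') :=
  .le_and (.trans (.and_left _ _) hφ) (.trans (.and_right _ _) hψ)

theorem or_mono {φ φ' ψ ψ' : Fm P} (hφ : Derives Γ φ φ') (hψ : Derives Γ ψ ψ') :
    Derives Γ (.or φ ψ) (.or φ' ψ') :=
  .or_le (.trans hφ (.or_left _ _)) (.trans hψ (.or_right _ _))

theorem le_subst (hσ : ∀ s, Derives Γ (.var s) (σ s)) (φ : Fm P) :
    Derives Γ φ (φ.subst σ) := by
  induction φ with
  | var s => exact hσ s
  | top => exact .refl _
  | bot => exact .refl _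
  | and _ _ ihφ ihψ => exact and_mono ihφ ihψ
  | or _ _ ihφ ihψ => exact or_mono ihφ ihψ
  | box _ ih => exact .box_mono ih
  | dia _ ih => exact .dia_mono ih

end Derives

open Classical in
/-- The substitution which erases the letters in `q` from a formula by replacing them by `⊤`. -/
noncomputable def erase (q : Set P) (s : P) : Fm P := if s ∈ q then .top else .var s

theorem vars_subst_erase (q : Set P) (φ : Fm P) : (φ.subst (erase q)).vars = φ.vars \ q := by
  ext t
  have mem_vars_erase (s : P) : t ∈ (erase q s).vars ↔ t = s ∧ s ∉ q := by
    by_cases hs : s ∈ q <;> simp [erase, Fm.vars, hs]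
  simp only [Fm.vars_subst, Set.mem_iUnion, mem_vars_erase, exists_prop, Set.mem_sdiff]
  exact ⟨fun ⟨_, hs, hts, hq⟩ => hts ▸ ⟨hs, hq⟩, fun ⟨ht, hq⟩ => ⟨t, ht, rfl, hq⟩⟩

theorem Derives.le_subst_erase (Γ : Set (Pair P)) (q : Set P) (φ : Fm P) :
    Derives Γ φ (φ.subst (erase q)) := by
  refine le_subst (fun s => ?_) φ
  by_cases hs : s ∈ q
  · simpa only [erase, if_pos hs] using Derives.le_top _
  · simpa only [erase, if_neg hs] using Derives.refl _

theorem subst_erase_eq_self {q : Set P} {φ : Fm P} (hφ : Disjoint φ.vars q) :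
    φ.subst (erase q) = φ :=
  Fm.subst_eq_self fun _ hs => if_neg (hφ.notMem_of_mem_left hs)

theorem craigInterpolation_logic (Γ : Set (Pair P)) : CraigInterpolation (logic Γ) := by
  intro p q r hpq _ hqr φ hφ ψ hψ h
  have hψq : Disjoint ψ.vars q := (hpq.union_left hqr.symm).mono_left hψ
  refine ⟨φ.subst (erase q), ?_, Derives.le_subst_erase Γ q φ, ?_⟩
  · change (φ.subst (erase q)).vars ⊆ p
    rw [vars_subst_erase, Set.sdiff_subset_iff, Set.union_comm]
    exact hφ
  · have hsubst := Derives.subst (erase q) h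
    rwa [subst_erase_eq_self hψq] at hsubst

end WeakPositive

namespace ClassicalModal

universe u

variable {P : Type*} {Γ : Set (Fm P)}

namespace Fm

/-- Conjunction, defined as `¬(φ → ¬ψ)`. -/
def and (φ ψ : Fm P) : Fm P := .neg (.imp φ (.neg ψ))

/-- Disjunction, defined as `¬φ → ψ`. -/
def or (φ ψ : Fm P) : Fm P := .imp (.neg φ) ψ

end Fm

/-! ### Kripke models -/

/-- Truth of a formula at a point of the Kripke model with accessibility relation `R` and
valuation `V`. -/
def Sat {W : Type*} (R : W → W → Prop) (V : P → W → Prop) : Fm P → W → Prop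
  | .var s, x => V s x
  | .bot, _ => False
  | .imp φ ψ, x => Sat R V φ x → Sat R V ψ x
  | .box φ, x => ∀ y, R x y → Sat R V φ y

section Sat

variable {W : Type*} {R : W → W → Prop} {V : P → W → Prop} {φ ψ : Fm P} {x : W}

theorem sat_box : Sat R V φ.box x ↔ ∀ y, R x y → Sat R V φ y := Iff.rfl

theorem sat_dia : Sat R V φ.dia x ↔ ∃ y, R x y ∧ Sat R V φ y := by
  simp [Fm.dia, Fm.neg, Sat]

theorem sat_and : Sat R V (φ.and ψ) x ↔ Sat R V φ x ∧ Sat R V ψ x := by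
  simp [Fm.and, Fm.neg, Sat]

theorem sat_box_and : Sat R V (φ.and ψ).box x ↔ Sat R V φ.box x ∧ Sat R V ψ.box x := by
  simp only [sat_box, sat_and, imp_and, forall_and]

theorem sat_or : Sat R V (φ.or ψ) x ↔ Sat R V φ x ∨ Sat R V ψ x := by
  simp [Fm.or, Fm.neg, Sat, or_iff_not_imp_left]

theorem sat_subst (σ : P → Fm P) :
    Sat R V (φ.subst σ) x ↔ Sat R (fun s => Sat R V (σ s)) φ x := by
  induction φ generalizing x with
  | var s => exact Iff.rfl
  | bot => exact Iff.rfl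
  | imp φ ψ ihφ ihψ => exact imp_congr ihφ ihψ
  | box φ ih => exact forall₂_congr fun _ _ => ih

theorem Derives.sat (hΓ : ∀ ψ ∈ Γ, ∀ V x, Sat R V ψ x) (h : Derives Γ φ) (V : P → W → Prop)
    (x : W) : Sat R V φ x := by
  induction h generalizing V x with
  | ax h => exact hΓ _ h V x
  | subst σ _ ih => exact (sat_subst σ).2 (ih _ x)
  | weak => exact fun hφ _ => hφ
  | distr => exact fun hφψχ hφψ hφ => hφψχ hφ (hφψ hφ)
  | dne => exact not_not.1
  | mp _ _ ih ih' => exact ih V x (ih' V x)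
  | boxK => exact fun hφψ hφ y hxy => hφψ y hxy (hφ y hxy)
  | nec _ ih => exact fun y _ => ih V y

theorem sat_of_mem_K2 (hR : ∀ x y z, R x y → R x z → ∃ w, R y w ∧ R z w) {p : P}
    (h : φ ∈ K2 p) (V : P → W → Prop) (x : W) : Sat R V φ x := by
  refine Derives.sat ?_ h V x
  rintro _ rfl V x hx y hxy
  obtain ⟨z, hxz, hz⟩ := sat_dia.1 hx
  obtain ⟨w, hyw, hzw⟩ := hR x y z hxy hxz
  exact sat_dia.2 ⟨w, hyw, hz w hzw⟩

theorem sat_iff_of_bisimulation {W' : Type*} {R' : W' → W' → Prop} {V' : P → W' → Prop}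
    {Z : W → W' → Prop} {S : Set P}
    (atom : ∀ s ∈ S, ∀ x x', Z x x' → (V s x ↔ V' s x'))
    (forth : ∀ x x', Z x x' → ∀ y, R x y → ∃ y', R' x' y' ∧ Z y y')
    (back : ∀ x x', Z x x' → ∀ y', R' x' y' → ∃ y, R x y ∧ Z y y')
    (hφ : φ ∈ Fm.formulasOver S) {x' : W'} (h : Z x x') : Sat R V φ x ↔ Sat R' V' φ x' := by
  induction φ generalizing x x' with
  | var s => exact atom s (hφ rfl) x x' h
  | bot => exact Iff.rfl
  | imp φ ψ ihφ ihψ =>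
    exact imp_congr (ihφ (fun _ hs => hφ (.inl hs)) h) (ihψ (fun _ hs => hφ (.inr hs)) h)
  | box φ ih =>
    constructor
    · intro hx y' hy'
      obtain ⟨y, hy, hyy'⟩ := back x x' h y' hy'
      exact (ih hφ hyy').1 (hx y hy)
    · intro hx y hy
      obtain ⟨y', hy', hyy'⟩ := forth x x' h y hy
      exact (ih hφ hyy').2 (hx y' hy')

end Sat

/-! ### The canonical model -/

theorem Derives.imp_self (φ : Fm P) : Derives Γ (.imp φ φ) :=
  .mp (.mp (.distr φ (.imp φ φ) φ) (.weak _ _)) (.weak φ φ)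

/-- A theory of `Γ`: a set of formulas containing the logic of `Γ` and closed under modus
ponens, but not necessarily under necessitation or substitution. -/
structure IsTheory (Γ T : Set (Fm P)) : Prop where
  thm {φ : Fm P} : Derives Γ φ → φ ∈ T
  mp {φ ψ : Fm P} : Fm.imp φ ψ ∈ T → φ ∈ T → ψ ∈ T

theorem isTheory_logic (Γ : Set (Fm P)) : IsTheory Γ (logic Γ) := ⟨id, .mp⟩

namespace IsTheory

variable {T : Set (Fm P)} {φ : Fm P}

theorem imp_mem (hT : IsTheory Γ T) (φ : Fm P) {ψ : Fm P} (hψ : ψ ∈ T) : Fm.imp φ ψ ∈ T :=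
  hT.mp (hT.thm (.weak ψ φ)) hψ

theorem setOf_imp_mem (hT : IsTheory Γ T) (φ : Fm P) : IsTheory Γ {ψ | Fm.imp φ ψ ∈ T} where
  thm h := hT.imp_mem φ (hT.thm h)
  mp h h' := hT.mp (hT.mp (hT.thm (.distr _ _ _)) h) h'

theorem setOf_box_mem (hT : IsTheory Γ T) : IsTheory Γ {ψ | Fm.box ψ ∈ T} where
  thm h := hT.thm (.nec h)
  mp h h' := hT.mp (hT.mp (hT.thm (.boxK _ _)) h) h'

theorem sUnion {c : Set (Set (Fm P))} (hc : ∀ T ∈ c, IsTheory Γ T) (hchain : IsChain (· ⊆ ·) c)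
    (hne : c.Nonempty) : IsTheory Γ (⋃₀ c) where
  thm h := let ⟨T, hT⟩ := hne; ⟨T, hT, (hc T hT).thm h⟩
  mp := by
    rintro _ _ ⟨T, hT, h⟩ ⟨U, hU, h'⟩
    obtain hTU | hUT := hchain.total hT hU
    · exact ⟨U, hU, (hc U hU).mp (hTU h) h'⟩
    · exact ⟨T, hT, (hc T hT).mp h (hUT h')⟩

theorem mem_of_bot_mem (hT : IsTheory Γ T) (h : Fm.bot ∈ T) (φ : Fm P) : φ ∈ T :=
  hT.mp (hT.thm (.dne φ)) (hT.imp_mem φ.neg h)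

end IsTheory

/-- The points of the canonical model of `Γ`: maximal consistent theories. -/
def IsMaxConsistent (Γ : Set (Fm P)) : Set (Fm P) → Prop :=
  Maximal fun T => IsTheory Γ T ∧ Fm.bot ∉ T

namespace IsMaxConsistent

variable {w : Set (Fm P)}

theorem neg_mem (hw : IsMaxConsistent Γ w) {φ : Fm P} (hφ : φ ∉ w) : φ.neg ∈ w := by
  by_contra hneg
  exact hφ <| hw.le_of_ge ⟨hw.prop.1.setOf_imp_mem φ, hneg⟩ (fun _ => hw.prop.1.imp_mem φ)
    (hw.prop.1.thm (.imp_self φ))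

theorem imp_mem_iff (hw : IsMaxConsistent Γ w) (φ ψ : Fm P) :
    Fm.imp φ ψ ∈ w ↔ (φ ∈ w → ψ ∈ w) := by
  refine ⟨hw.prop.1.mp, fun h => ?_⟩
  by_cases hφ : φ ∈ w
  · exact hw.prop.1.imp_mem φ (h hφ)
  · exact (hw.prop.1.setOf_imp_mem φ).mem_of_bot_mem (hw.neg_mem hφ) ψ

end IsMaxConsistent

theorem IsTheory.exists_isMaxConsistent {T : Set (Fm P)} (hT : IsTheory Γ T) (hbot : Fm.bot ∉ T) :
    ∃ w, IsMaxConsistent Γ w ∧ T ⊆ w := by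
  refine (zorn_subset_nonempty {T | IsTheory Γ T ∧ Fm.bot ∉ T} (fun c hc hchain hne => ?_) T
    ⟨hT, hbot⟩).imp fun w hw => ⟨hw.2, hw.1⟩
  refine ⟨⋃₀ c, ⟨.sUnion (fun U hU => (hc hU).1) hchain hne, ?_⟩, fun _ => Set.subset_sUnion_of_mem⟩
  rintro ⟨U, hU, hbotU⟩
  exact (hc hU).2 hbotU

theorem IsTheory.mem_iff_forall_isMaxConsistent {T : Set (Fm P)} (hT : IsTheory Γ T) {φ : Fm P} :
    φ ∈ T ↔ ∀ w, IsMaxConsistent Γ w → T ⊆ w → φ ∈ w := by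
  refine ⟨fun hφ w _ hTw => hTw hφ, fun h => ?_⟩
  by_contra hφ
  obtain ⟨w, hw, hsub⟩ := (hT.setOf_imp_mem φ.neg).exists_isMaxConsistent
    fun hbot => hφ (hT.mp (hT.thm (.dne φ)) hbot)
  have hneg : φ.neg ∈ w := hsub (hT.thm (.imp_self _))
  exact hw.prop.2 (hw.prop.1.mp hneg (h w hw fun ψ hψ => hsub (hT.imp_mem _ hψ)))

/-- Accessibility in the canonical model. -/
def Access (w u : {w // IsMaxConsistent Γ w}) : Prop := {φ | Fm.box φ ∈ w.1} ⊆ u.1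

theorem sat_canonical_iff (w : {w // IsMaxConsistent Γ w}) (φ : Fm P) :
    Sat Access (fun s w => .var s ∈ w.1) φ w ↔ φ ∈ w.1 := by
  induction φ generalizing w with
  | var s => exact Iff.rfl
  | bot => exact iff_of_false id w.2.prop.2
  | imp φ ψ ihφ ihψ => exact (imp_congr (ihφ w) (ihψ w)).trans (w.2.imp_mem_iff φ ψ).symm
  | box φ ih =>
    refine Iff.trans ?_ w.2.prop.1.setOf_box_mem.mem_iff_forall_isMaxConsistent.symm
    exact Subtype.forall.trans <| forall₂_congr fun u hu => imp_congr_right fun _ => ih ⟨u, hu⟩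

theorem derives_of_forall_sat {P : Type u} {Γ : Set (Fm P)} {φ : Fm P}
    (h : ∀ (W : Type u) (R : W → W → Prop) (V : P → W → Prop),
      (∀ ψ, Derives Γ ψ → ∀ x, Sat R V ψ x) → ∀ x, Sat R V φ x) : Derives Γ φ := by
  refine (isTheory_logic Γ).mem_iff_forall_isMaxConsistent.2 fun w hw _ => ?_
  refine (sat_canonical_iff ⟨w, hw⟩ φ).1 (h _ _ _ (fun ψ hψ x => ?_) _)
  exact (sat_canonical_iff x ψ).2 (x.2.prop.1.thm hψ)

/-! ### Forks -/

/-- The formula `◇□α ∧ ◇□β ∧ □(□α ∨ □β)`: the successors of a point split into those which force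
`α` and those which force `β`, and both kinds occur. -/
def fork (α β : Fm P) : Fm P :=
  .and α.box.dia (.and β.box.dia (.box (.or α.box β.box)))

theorem vars_fork (α β : Fm P) : (fork α β).vars = α.vars ∪ β.vars := by
  ext
  simp only [fork, Fm.and, Fm.or, Fm.dia, Fm.neg, Fm.vars, Set.mem_union]
  tauto

section Sat

variable {W : Type*} {R : W → W → Prop} {V : P → W → Prop} {α β γ δ : Fm P} {x : W}

theorem sat_fork : Sat R V (fork α β) x ↔
    (∃ y, R x y ∧ Sat R V α.box y) ∧ (∃ y, R x y ∧ Sat R V β.box y) ∧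
      ∀ y, R x y → Sat R V α.box y ∨ Sat R V β.box y := by
  rw [fork, sat_and, sat_and, sat_dia, sat_dia, sat_box]
  simp only [sat_or]

theorem exists_sat_and_of_sat_box
    (hdot2 : ∀ φ v, Sat R V (.imp (.dia (.box φ)) (.box (.dia φ))) v)
    {y z : W} (hxy : R x y) (hxz : R x z) (hα : Sat R V α.box y) (hβ : Sat R V β.box z) :
    ∃ v, Sat R V α v ∧ Sat R V β v := by
  obtain ⟨v, hzv, hv⟩ := sat_dia.1 (hdot2 α x (sat_dia.2 ⟨y, hxy, hα⟩) z hxz)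
  exact ⟨v, hv, hβ v hzv⟩

theorem not_sat_box_of_sat_box
    (hdot2 : ∀ φ v, Sat R V (.imp (.dia (.box φ)) (.box (.dia φ))) v)
    (hcontra : ∀ v, Sat R V α v → Sat R V β v → Sat R V γ v → ¬ Sat R V δ v)
    {y z : W} (hxy : R x y) (hxz : R x z) (hα : Sat R V α.box y) (hβ : Sat R V β.box y)
    (hγ : Sat R V γ.box z) : ¬ Sat R V δ.box z := by
  intro hδ
  obtain ⟨v, hαβ, hγδ⟩ := exists_sat_and_of_sat_box hdot2 hxy hxz
    (sat_box_and.2 ⟨hα, hβ⟩) (sat_box_and.2 ⟨hγ, hδ⟩)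
  obtain ⟨hα, hβ⟩ := sat_and.1 hαβ
  obtain ⟨hγ, hδ⟩ := sat_and.1 hγδ
  exact hcontra v hα hβ hγ hδ

theorem not_sat_fork_of_sat_fork
    (hdot2 : ∀ φ v, Sat R V (.imp (.dia (.box φ)) (.box (.dia φ))) v)
    (hcontra : ∀ v, Sat R V α v → Sat R V β v → Sat R V γ v → ¬ Sat R V δ v)
    (h : Sat R V (fork α β) x) : ¬ Sat R V (fork γ δ) x := by
  intro h'
  obtain ⟨⟨a, hxa, ha⟩, ⟨b, hxb, hb⟩, hαβ⟩ := sat_fork.1 h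
  obtain ⟨⟨c, hxc, hc⟩, ⟨d, hxd, hd⟩, hγδ⟩ := sat_fork.1 h'
  have clash_αγ_βδ {y z : W} (hxy : R x y) (hxz : R x z) :=
    not_sat_box_of_sat_box hdot2 (fun v hα hγ hβ => hcontra v hα hβ hγ) hxy hxz
  have clash_αδ_βγ {y z : W} (hxy : R x y) (hxz : R x z) :=
    not_sat_box_of_sat_box hdot2 (fun v hα hδ hβ hγ => hcontra v hα hβ hγ hδ) hxy hxz
  rcases hγδ a hxa with haγ | haδ
  · have hbγ := (hγδ b hxb).resolve_right (clash_αγ_βδ hxa hxb ha haγ hb)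
    have hdα := (hαβ d hxd).resolve_right fun hdβ => clash_αγ_βδ hxa hxd ha haγ hdβ hd
    exact clash_αδ_βγ hxd hxb hdα hd hb hbγ
  · have hbδ := (hγδ b hxb).resolve_left (clash_αδ_βγ hxa hxb ha haδ hb)
    have hcα := (hαβ c hxc).resolve_right fun hcβ => clash_αδ_βγ hxa hxc ha haδ hcβ hc
    exact clash_αγ_βδ hxc hxb hcα hc hb hbδ

end Sat

theorem fork_imp_neg_fork_mem_K2 (p : P) (α γ φ : Fm P) :
    Fm.imp (fork α (.imp α φ)) (.neg (fork γ (.imp γ φ.neg))) ∈ K2 p := by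
  refine derives_of_forall_sat fun W R V hmodel x => not_sat_fork_of_sat_fork (fun ψ => ?_) ?_
  · exact hmodel _ (.subst (fun _ => ψ) (.ax (Set.mem_singleton _)))
  · exact fun _ hα hφ hγ hnφ => hnφ hγ (hφ hα)

/-- A confluent frame: the root `0` sees every other point, `1` and `2` see each other and
themselves, and `3` sees `1` and itself. -/
abbrev ForkRel (x y : Fin 4) : Prop :=
  y ∈ (![{1, 2, 3}, {1, 2}, {1, 2}, {1, 3}] : Fin 4 → Finset (Fin 4)) x

/-- The valuation on `ForkRel` making `q` true at `1` and `2`, and `s` true on `S`. -/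
def forkVal (q s : P) (S : Finset (Fin 4)) (l : P) (x : Fin 4) : Prop :=
  l = q ∧ x ∈ ({1, 2} : Finset (Fin 4)) ∨ l = s ∧ x ∈ S

section Countermodel

variable {q r s : P} {S : Finset (Fin 4)} {φ : Fm P}

theorem forkVal_left (hqs : q ≠ s) (x : Fin 4) :
    forkVal q s S q x ↔ x ∈ ({1, 2} : Finset (Fin 4)) := by
  simp only [forkVal, hqs, true_and, false_and, or_false]

theorem forkVal_right (hqs : q ≠ s) (x : Fin 4) : forkVal q s S s x ↔ x ∈ S := by
  simp only [forkVal, hqs.symm, true_and, false_and, false_or]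

theorem sat_fork_forkVal (hqs : q ≠ s) (hφ : Sat ForkRel (forkVal q s S) φ 1) :
    Sat ForkRel (forkVal q s S) (fork (.var q) (.imp (.var q) φ)) 0 := by
  have box_q {y : Fin 4} (hy : y = 1 ∨ y = 2) : Sat ForkRel (forkVal q s S) (.box (.var q)) y := by
    intro z hz
    rw [Sat, forkVal_left hqs]
    revert y z
    decide
  have box_imp : Sat ForkRel (forkVal q s S) (.box (.imp (.var q) φ)) 3 := by
    intro z hz hq
    rw [Sat, forkVal_left hqs] at hq
    obtain rfl : z = 1 := by
      revert z
      decide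
    exact hφ
  have successor_root : ∀ y, ForkRel 0 y → (y = 1 ∨ y = 2) ∨ y = 3 := by decide
  refine sat_fork.2 ⟨⟨1, by decide, box_q (.inl rfl)⟩, ⟨3, by decide, box_imp⟩, fun y hy => ?_⟩
  exact (successor_root y hy).imp box_q fun h => by rwa [h]

theorem sat_forkVal_iff (hqs : q ≠ s) (hrs : r ≠ s) (hφ : φ ∈ Fm.formulasOver {s}) :
    Sat ForkRel (forkVal q s {1}) φ 0 ↔ Sat ForkRel (forkVal r s {2, 3}) φ 0 := by
  -- In both models every point sees a point where `s` is true and one where it is false.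
  refine sat_iff_of_bisimulation (S := {s})
    (Z := fun x y => x ∈ ({1} : Finset (Fin 4)) ↔ y ∈ ({2, 3} : Finset (Fin 4)))
    ?_ (by decide) (by decide) hφ (by decide)
  rintro _ rfl x y hxy
  rw [forkVal_right hqs, forkVal_right hrs, hxy]

end Countermodel

theorem not_craigInterpolation_K2 {q r s : P} (hqr : q ≠ r) (hqs : q ≠ s) (hrs : r ≠ s) (p : P) :
    ¬ CraigInterpolation (K2 p) := by
  intro hC
  obtain ⟨χ, hχ, hleft, hright⟩ := hC {s} {q} {r} (Set.disjoint_singleton.2 hqs.symm)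
    (Set.disjoint_singleton.2 hrs.symm) (Set.disjoint_singleton.2 hqr)
    (fork (.var q) (.imp (.var q) (.var s)))
    (by simp [Fm.formulasOver, vars_fork, Fm.vars, Set.pair_comm])
    (.neg (fork (.var r) (.imp (.var r) (.neg (.var s)))))
    (by simp [Fm.formulasOver, vars_fork, Fm.vars, Fm.neg, Set.pair_comm])
    (fork_imp_neg_fork_mem_K2 p _ _ _)
  have hR : ∀ x y z, ForkRel x y → ForkRel x z → ∃ w, ForkRel y w ∧ ForkRel z w := by decide
  have hforkq : Sat ForkRel (forkVal q s {1}) (fork (.var q) (.imp (.var q) (.var s))) 0 :=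
    sat_fork_forkVal hqs ((forkVal_right hqs 1).2 (by decide))
  have hforkr : Sat ForkRel (forkVal r s {2, 3})
      (fork (.var r) (.imp (.var r) (.neg (.var s)))) 0 :=
    sat_fork_forkVal hrs fun h => absurd ((forkVal_right hrs 1).1 h) (by decide)
  have hχq : Sat ForkRel (forkVal q s {1}) χ 0 := sat_of_mem_K2 hR hleft _ _ hforkq
  exact sat_of_mem_K2 hR hright _ _ ((sat_forkVal_iff hqs hrs hχ).1 hχq) hforkr

end ClassicalModal

theorem mainTheorem4_general :
    (∀ (P : Type*) (Γ : Set (WeakPositive.Pair P)),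
      WeakPositive.CraigInterpolation (WeakPositive.logic Γ)) ∧
    (∀ (P : Type*) (p : P), 3 ≤ ENat.card P →
      ¬ ClassicalModal.CraigInterpolation (ClassicalModal.K2 p)) := by
  refine ⟨fun _ Γ => WeakPositive.craigInterpolation_logic Γ, fun P s hP => ?_⟩
  obtain ⟨q, hqs, -⟩ := ENat.exists_ne_ne_of_three_le hP s s
  obtain ⟨r, hrq, hrs⟩ := ENat.exists_ne_ne_of_three_le hP q s
  exact ClassicalModal.not_craigInterpolation_K2 hrq.symm hqs hrs s

theorem mainTheorem4 :
    (∀ (P : Type*) (p : P) (Γ : Set WeakPositive.AxiomName),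
      WeakPositive.CraigInterpolation (WeakPositive.logic (⋃ A ∈ Γ, A.pairs p))) ∧
    (∀ (P : Type*) [Infinite P] (p : P),
      ¬ ClassicalModal.CraigInterpolation (ClassicalModal.K2 p)) := by
  obtain ⟨positive, classical⟩ := mainTheorem4_general
  exact ⟨fun P _ _ => positive P _, fun P _ p => classical P p (by simp)⟩
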